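/- Let $S$ be a finite set, let $M=(m_{s,t})_{s,t\in S}$ be a Coxeter matrix with Coxeter graph $\Gamma$, and let $(W,S)$ be its Coxeter system, with word length $\lg$. For $X\subset S$ let $W_X$ be the subgroup of $W$ generated by $X$, and let $\Gamma_X$ be the Coxeter graph of $(m_{s,t})_{s,t\in X}$. For $X,Y\subset S$, an element $w\in W$ is called $(X,Y)$-reduced if it has minimal length in the double coset $W_XwW_Y$. Let $\mathcal S^f$ be the set of $X\subset S$ such that $W_X$ is finite. On $W\times\mathcal S^f$ put $(u,X)\le(v,Y)$ if $X\subset Y$, $v^{-1}u\in W_Y$ and $v^{-1}u$ is $(\emptyset,X)$-reduced. The Charney–Davis–Salvetti complex $\Omega(\Gamma)$ is the geometric realization (with the weak topology) of the simplicial complex of non-empty finite chains of $(W\times\mathcal S^f,\le)$; the group $W$ acts on it through left multiplication on the first factor of $W \times \mathcal S^f$. For $T\subset S$ the Coxeter group of $\Gamma_T$ is identified with $W_T$ by the natural homomorphism (which is injective with image $W_T$), and we write $\mathcal S^f_T=\{X\in\mathcal S^f : X\subset T\}$. **Theorem.** (1) Let $T\subset S$. The inclusion $W_T\times\mathcal S^f_T\hookrightarrow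 W\times\mathcal S^f$ preserves and reflects $\le$, and it induces a $W_T$-equivariant topological embedding $\Omega(\Gamma_T)\hookrightarrow\Omega(\Gamma)$. Every $u\in W$ can be written uniquely as $u=u_0u_1$ with $u_0\in W_T$ and $u_1$ a $(T,\emptyset)$-reduced element. The map $$W\times\mathcal S^f\to W_T\times\mathcal S^f_T,\qquad (u,X)\mapsto\bigl(u_0,\;T\cap u_1W_Xu_1^{-1}\bigr)$$ is well defined and order-preserving, and it induces a continuous $W_T$-equivariant map $\pi_T:\Omega(\Gamma)\to\Omega(\Gamma_T)$ whose restriction to $\Omega(\Gamma_T)$ is the identity; that is, $\pi_T$ is a $W_T$-equivariant retraction of the embedding. (2) Let $R,T\subset S$. The restriction of $\pi_T$ to $\Omega(\Gamma_R)$ coincides with the retraction $\pi_{R\cap T}:\Omega(\Gamma_R)\to\Omega(\Gamma_{R\cap T})$ obtained from (1) for $\Gamma_R$ and the subset $R\cap T$ of $R$, where $\Omega(\Gamma_{R\cap T})$ is regarded as a subspace of $\Omega(\Gamma_T)$ through the embedding of (1) for $\Gamma_T$. -/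

import Mathlib

namespace CDS

noncomputable section

/-! ### Coxeter groups, standard parabolic subgroups, reduced elements -/

/-- The Coxeter matrix of the full subgraph of the Coxeter graph of `M` on a set of vertices
given as the range of an embedding `f`. For `T : Set B` and `f` the inclusion of `T`, this is the
matrix `M_T`, that is, the Coxeter graph `Γ_T`. -/
def restrict {A B : Type*} (M : CoxeterMatrix B) (f : A ↪ B) : CoxeterMatrix A where
  M := fun a b => M (f a) (f b)
  isSymm := by
    ext a b
    exact M.symmetric (f b) (f a)
  diagonal a := M.diagonal (f a)
  off_diagonal a b h := M.off_diagonal (f a) (f b) (f.injective.ne h)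

/-- The inclusion of a subset `T` of `B`, as an embedding. -/
abbrev incl {B : Type*} (T : Set B) : T ↪ B := Function.Embedding.subtype (· ∈ T)

/-- The inclusion of `T` in `U`, for `T ⊆ U ⊆ B`, as an embedding. -/
abbrev inclOf {B : Type*} {T U : Set B} (h : T ⊆ U) : T ↪ U := Set.embeddingOfSubset T U h

/-- The length of an element of the Coxeter group of `M`: the shortest length of a word on the
canonical generators representing it. -/
def len {B : Type*} (M : CoxeterMatrix B) (w : M.Group) : ℕ := M.toCoxeterSystem.length w

/-- The standard parabolic subgroup `W_X`, generated by `X`. -/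
def parabolic {B : Type*} (M : CoxeterMatrix B) (X : Set B) : Subgroup M.Group :=
  Subgroup.closure (M.simple '' X)

/-- `w` is `(X,Y)`-reduced: it has minimal length in the double coset `W_X w W_Y`. -/
def IsDoubleReduced {B : Type*} (M : CoxeterMatrix B) (X Y : Set B) (w : M.Group) : Prop :=
  ∀ v ∈ DoubleCoset.doubleCoset w (parabolic M X : Set M.Group) (parabolic M Y : Set M.Group),
    len M w ≤ len M v

/-- `𝒮^f`: the set of subsets `X` of the generating set such that `W_X` is finite. -/
def Spherical {B : Type*} (M : CoxeterMatrix B) : Set (Set B) :=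
  {X | Finite (parabolic M X)}

/-- The set `W × 𝒮^f`. -/
abbrev Vertex {B : Type*} (M : CoxeterMatrix B) : Type _ := M.Group × Spherical M

/-- The relation on `W × 𝒮^f`: `(u,X) ≤ (v,Y)` if `X ⊆ Y`, `v⁻¹u ∈ W_Y` and `v⁻¹u` is
`(∅,X)`-reduced. -/
def VLE {B : Type*} (M : CoxeterMatrix B) (p q : Vertex M) : Prop :=
  (p.2 : Set B) ⊆ q.2 ∧ q.1⁻¹ * p.1 ∈ parabolic M q.2 ∧ IsDoubleReduced M ∅ p.2 (q.1⁻¹ * p.1)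

/-- The natural homomorphism from the Coxeter group of the full subgraph to that of `M`, sending
each generator `a` to the generator `f a`. -/
def groupIncl {A B : Type*} (M : CoxeterMatrix B) (f : A ↪ B) :
    (restrict M f).Group →* M.Group :=
  (restrict M f).toCoxeterSystem.lift
    ⟨fun a => M.simple (f a), fun a b => by
      have h := M.toCoxeterSystem.simple_mul_simple_pow (f a) (f b)
      rw [M.toCoxeterSystem_simple] at h
      exact h⟩

theorem groupIncl_simple {A B : Type*} (M : CoxeterMatrix B) (f : A ↪ B) (a : A) :
    groupIncl M f ((restrict M f).simple a) = M.simple (f a) := by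
  have h := (restrict M f).toCoxeterSystem.lift_apply_simple
    (f := fun a => M.simple (f a)) (fun a b => by
      have h := M.toCoxeterSystem.simple_mul_simple_pow (f a) (f b)
      rw [M.toCoxeterSystem_simple] at h
      exact h) a
  simpa [groupIncl] using h

theorem map_parabolic {A B : Type*} (M : CoxeterMatrix B) (f : A ↪ B) (X : Set A) :
    (parabolic (restrict M f) X).map (groupIncl M f) = parabolic M (f '' X) := by
  simp only [parabolic, MonoidHom.map_closure, Set.image_image, groupIncl_simple]

theorem spherical_image {A B : Type*} (M : CoxeterMatrix B) (f : A ↪ B)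
    (X : Spherical (restrict M f)) : f '' (X : Set A) ∈ Spherical M := by
  have hX : Finite (parabolic (restrict M f) (X : Set A)) := X.2
  change Finite (parabolic M (f '' (X : Set A)))
  rw [← map_parabolic]
  exact Finite.of_surjective _
    ((groupIncl M f).subgroupMap_surjective (parabolic (restrict M f) (X : Set A)))

/-- The natural map `W_T × 𝒮^f_T → W × 𝒮^f`. -/
def vertexIncl {A B : Type*} (M : CoxeterMatrix B) (f : A ↪ B) (p : Vertex (restrict M f)) :
    Vertex M :=
  (groupIncl M f p.1, ⟨f '' (p.2 : Set A), spherical_image M f p.2⟩)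

/-! ### Order complexes and their geometric realizations -/

/-- The derived complex of a set with a relation `r`: the faces are the non-empty finite chains. -/
def derivedComplex {V : Type*} (r : V → V → Prop) : AbstractSimplicialComplex V where
  faces := {s | s.Nonempty ∧ IsChain r (s : Set V)}
  isRelLowerSet_faces := fun _ hs =>
    ⟨hs.1, fun _ hts ht => ⟨ht, hs.2.mono (Finset.coe_subset.mpr hts)⟩⟩
  singleton_mem v := ⟨Finset.singleton_nonempty v, by simp⟩

/-- The points of the geometric realization of an abstract simplicial complex, given by their
barycentric coordinates. -/
@[ext]
structure Realization {V : Type*} (K : AbstractSimplicialComplex V) where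
  /-- the barycentric coordinates -/
  coord : V →₀ ℝ
  nonneg : ∀ v, 0 ≤ coord v
  sum_eq_one : (coord.sum fun _ a => a) = 1
  support_mem : coord.support ∈ K.faces

theorem nonempty_of_sum_eq_one {V : Type*} {x : V →₀ ℝ} (h : (x.sum fun _ a => a) = 1) :
    x.support.Nonempty := by
  rw [Finset.nonempty_iff_ne_empty]
  intro h0
  rw [Finsupp.support_eq_empty] at h0
  simp [h0] at h

/-- The function on `V` with the given values on the finite set `s`, and zero outside `s`. -/
def extendByZero {V : Type*} (s : Finset V) (x : s → ℝ) : V →₀ ℝ :=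
  Finsupp.embDomain (Function.Embedding.subtype (· ∈ s)) (Finsupp.equivFunOnFinite.symm x)

theorem extendByZero_support {V : Type*} (s : Finset V) (x : s → ℝ) :
    (extendByZero s x).support ⊆ s := by
  intro v hv
  rw [extendByZero, Finsupp.support_embDomain, Finset.mem_map] at hv
  obtain ⟨a, -, rfl⟩ := hv
  exact a.2

theorem extendByZero_nonneg {V : Type*} (s : Finset V) (x : s → ℝ) (h : ∀ a, 0 ≤ x a) (v : V) :
    0 ≤ extendByZero s x v := by
  by_cases hv : v ∈ s
  · have := Finsupp.embDomain_apply_self (Function.Embedding.subtype (· ∈ s))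
      (Finsupp.equivFunOnFinite.symm x) ⟨v, hv⟩
    exact le_of_le_of_eq (h ⟨v, hv⟩) this.symm
  · have h0 : extendByZero s x v = 0 := by
      by_contra hne
      exact hv (extendByZero_support s x (Finsupp.mem_support_iff.mpr hne))
    exact h0.ge

theorem extendByZero_sum {V : Type*} (s : Finset V) (x : s → ℝ) (h : ∑ a, x a = 1) :
    ((extendByZero s x).sum fun _ a => a) = 1 := by
  rw [extendByZero, Finsupp.sum_embDomain, Finsupp.sum_fintype _ _ (fun _ => rfl)]
  simpa using h

/-- The closed simplex of the geometric realization spanned by a face `s`. -/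
def closedSimplex {V : Type*} (K : AbstractSimplicialComplex V) (s : K.faces)
    (x : stdSimplex ℝ (s : Finset V)) : Realization K :=
  ⟨extendByZero (s : Finset V) x.1, extendByZero_nonneg _ _ x.2.1, extendByZero_sum _ _ x.2.2,
    (K.isRelLowerSet_faces s.2).2 (extendByZero_support _ _)
      (nonempty_of_sum_eq_one (extendByZero_sum _ _ x.2.2))⟩

/-- The usual (weak) topology of the geometric realization: a set is open if and only if its trace
on every closed simplex is open. -/
instance {V : Type*} (K : AbstractSimplicialComplex V) : TopologicalSpace (Realization K) :=
  ⨆ s : K.faces, TopologicalSpace.coinduced (closedSimplex K s) inferInstance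

/-- The map between the realizations of the derived complexes which is induced by a
relation-preserving map: the map which is `φ` on vertices and affine on every simplex. -/
def realMap {V V' : Type*} {r : V → V → Prop} {r' : V' → V' → Prop} (φ : r →r r')
    (x : Realization (derivedComplex r)) : Realization (derivedComplex r') where
  coord := Finsupp.mapDomain φ x.coord
  nonneg v := by
    classical
    rw [Finsupp.mapDomain, Finsupp.sum_apply]
    refine Finset.sum_nonneg fun w _ => ?_
    dsimp only
    rw [Finsupp.single_apply]
    split_ifs
    · exact x.nonneg w
    · exact le_rfl
  sum_eq_one := by
    rw [Finsupp.sum_mapDomain_index (fun _ => rfl) (fun _ _ _ => rfl)]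
    exact x.sum_eq_one
  support_mem := by
    classical
    refine ⟨nonempty_of_sum_eq_one ?_, ?_⟩
    · rw [Finsupp.sum_mapDomain_index (fun _ => rfl) (fun _ _ _ => rfl)]
      exact x.sum_eq_one
    · have hc : IsChain r' (φ '' (x.coord.support : Set V)) :=
        x.support_mem.2.image_of_map_rel r r' φ (fun _ _ h => φ.map_rel h)
      refine hc.mono fun v hv => ?_
      have := Finsupp.mapDomain_support hv
      simpa using this

/-! ### The Charney-Davis-Salvetti complex -/

/-- The Charney-Davis-Salvetti complex `Ω(Γ)`. -/
abbrev Omega {B : Type*} (M : CoxeterMatrix B) : Type _ := Realization (derivedComplex (VLE M))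

/-- Left translation by `w` on `W × 𝒮^f`. -/
def translate {B : Type*} (M : CoxeterMatrix B) (w : M.Group) : VLE M →r VLE M where
  toFun p := (w * p.1, p.2)
  map_rel' := by
    intro p q h
    have e : (w * q.1)⁻¹ * (w * p.1) = q.1⁻¹ * p.1 := by group
    simpa only [VLE, e] using h

/-- The action of the Coxeter group on `Ω(Γ)`, induced by left translation on `W × 𝒮^f`. -/
instance {B : Type*} (M : CoxeterMatrix B) : MulAction M.Group (Omega M) where
  smul w := realMap (translate M w)
  one_smul x := by
    apply Realization.ext
    change Finsupp.mapDomain (translate M 1) x.coord = x.coord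
    have : ⇑(translate M 1) = id := by
      funext p
      simp [translate]
    rw [this, Finsupp.mapDomain_id]
  mul_smul v w x := by
    apply Realization.ext
    change Finsupp.mapDomain (translate M (v * w)) x.coord =
      Finsupp.mapDomain (translate M v) (Finsupp.mapDomain (translate M w) x.coord)
    rw [← Finsupp.mapDomain_comp]
    congr 1
    funext p
    simp [translate, mul_assoc]

/-- `(u₀, u₁)` is the decomposition `u = u₀ u₁` with `u₀ ∈ W_T` and `u₁` a `(T,∅)`-reduced
element, where `T` is the range of `f`. -/
def IsDecomposition {A B : Type*} (M : CoxeterMatrix B) (f : A ↪ B) (u : M.Group)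
    (d : (restrict M f).Group × M.Group) : Prop :=
  u = groupIncl M f d.1 * d.2 ∧ IsDoubleReduced M (Set.range f) ∅ d.2

/-- The map `π` is given by `π(u,X) = (u₀, T ∩ u₁ W_X u₁⁻¹)`, where `T` is the range of `f` and
`u = u₀ u₁` is the unique decomposition with `u₀ ∈ W_T` and `u₁` a `(T,∅)`-reduced element. Such a
map is unique. -/
def IsProjection {A B : Type*} (M : CoxeterMatrix B) (f : A ↪ B)
    (π : Vertex M → Vertex (restrict M f)) : Prop :=
  ∀ u : M.Group, (∃! d, IsDecomposition M f u d) ∧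
    ∀ d, IsDecomposition M f u d → ∀ X : Spherical M,
      (π (u, X)).1 = d.1 ∧
      ((π (u, X)).2 : Set A) =
        {t | ∃ w ∈ parabolic M X, M.simple (f t) = d.2 * w * d.2⁻¹}

end

end CDS

namespace CDS

noncomputable section

/-! ### The geometric representation -/

/-! All the work is on vertices: a relation-preserving vertex map extends affinely to a continuous
map of realizations (`continuous_realMap`), and identities between such maps can be checked on
vertices (`realMap_realMap_eq`).

The group theory is read off the geometric representation. Every `w α_s` is nonnegative or
nonpositive, and it is nonnegative exactly when `ℓ(w s) > ℓ(w)` (`geom_root_nonneg_iff`); elements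
of `W_X` alter only the coordinates in `X` (`geom_parabolic_apply`). Reducedness thus becomes a sign
condition on roots (`isDoubleReduced_empty_left_iff`). Lengths add in `W_T` times a `(T,∅)`-reduced
element (`len_groupIncl_mul`), which gives the unique decomposition `u = u₀ u₁`.

The heart is that `π` preserves order (`projFun_vle`). If `(u,X) ≤ (v,Y)`, put `y = v⁻¹u` and `x =
v₀⁻¹u₀`, so that `v₁ y = x u₁`. The first letter `t` of a reduced word of `x` shortens `v₁ y` but
not `v₁`, so by an exchange argument `t ∈ v₁ W_Y v₁⁻¹`. Stripping letters puts `x` in the parabolic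
subgroup on `T ∩ v₁ W_Y v₁⁻¹` (`mem_parabolic_conjTrace`). Inclusion of the traces follows by
conjugation, and reducedness of `x` by comparing signs of roots.

On `W_T` one has `u₁ = 1`, so `π` is a retraction. For `u ∈ W_R`, the decomposition relative to `R ∩
T` is already the one relative to `T`, whence the compatibility (`projFun_vertexIncl_inter`). -/

/-- The simple coroot at `s`: the linear form taking the value `-2 cos (π / m_{s,t})` at the
simple root at `t`. -/
def coroot {B : Type*} (M : CoxeterMatrix B) (s : B) : Module.Dual ℝ (B →₀ ℝ) :=
  Finsupp.linearCombination ℝ fun t => -2 * Real.cos (Real.pi / M s t)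

/-- The simple root at `s`. -/
abbrev root {B : Type*} (s : B) : B →₀ ℝ := Finsupp.single s 1

theorem coroot_root {B : Type*} (M : CoxeterMatrix B) (s t : B) :
    coroot M s (root t) = -2 * Real.cos (Real.pi / M s t) := by
  simp [coroot]

theorem coroot_root_self {B : Type*} (M : CoxeterMatrix B) (s : B) :
    coroot M s (root s) = 2 := by
  simp [coroot_root]

theorem coroot_root_comm {B : Type*} (M : CoxeterMatrix B) (s t : B) :
    coroot M s (root t) = coroot M t (root s) := by
  rw [coroot_root, coroot_root, M.symmetric]

/-- The reflection at the simple root at `s`. -/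
def simpleReflection {B : Type*} (M : CoxeterMatrix B) (s : B) : (B →₀ ℝ) ≃ₗ[ℝ] (B →₀ ℝ) :=
  Module.reflection (coroot_root_self M s)

theorem simpleReflection_apply {B : Type*} (M : CoxeterMatrix B) (s : B) (v : B →₀ ℝ) :
    simpleReflection M s v = v - coroot M s v • root s :=
  Module.reflection_apply _ _

open Polynomial.Chebyshev in
theorem simpleReflection_isLiftable {B : Type*} (M : CoxeterMatrix B) :
    M.IsLiftable (simpleReflection M) := by
  intro s t
  rcases eq_or_ne s t with rfl | hst
  · rw [M.diagonal, pow_one]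
    ext1 v
    exact Module.involutive_reflection (coroot_root_self M s) v
  have h1 : M s t ≠ 1 := M.off_diagonal s t hst
  -- The entry 0 stands for infinity and imposes no relation.
  rcases Nat.eq_zero_or_pos (M s t) with h0 | hpos
  · rw [h0, pow_zero]
  apply LinearEquiv.ext
  intro v
  rw [simpleReflection, simpleReflection, Module.reflection_mul_reflection_pow_apply
    (coroot_root_self M s) (coroot_root_self M t) (M s t) v]
  rw [coroot_root_comm M t s, coroot_root]
  generalize hm : M s t = m at *
  -- For `m = 2` the angle `2π/m` is `π`, whose sine vanishes, so the division by `sin φ` below is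
  -- not available.
  obtain rfl | hm2 : m = 2 ∨ 3 ≤ m := by omega
  · simp only [Nat.cast_ofNat, sub_self, Int.reduceSub, Int.reduceDiv, S_zero, S_neg_one, S_one,
      Polynomial.eval_one, Polynomial.eval_zero, Polynomial.eval_X, Real.cos_pi_div_two,
      LinearEquiv.coe_one, id]
    module
  · have hm0 : (0 : ℝ) < m := by exact_mod_cast hpos
    -- The Chebyshev argument `4 cos²(π/m) - 2` equals `2 cos φ`, and `S_n(2 cos φ) sin φ =
    -- sin((n+1)φ)`. With `m φ = 2π` this annihilates `S_{k-1}` if `m = 2k`, and `S_k + S_{k-1}` if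
    -- `m = 2k+1`.
    set φ : ℝ := 2 * Real.pi / m with hφ
    have hmφ : m * φ = 2 * Real.pi := by rw [hφ]; field_simp
    have ht : -2 * Real.cos (Real.pi / m) * (-2 * Real.cos (Real.pi / m)) - 2
        = 2 * Real.cos φ := by
      have : φ = 2 * (Real.pi / m) := by rw [hφ]; ring
      rw [this, Real.cos_two_mul]
      ring
    have hφ0 : 0 < φ := by positivity
    have hφπ : φ < Real.pi := by
      rw [hφ, div_lt_iff₀ hm0]
      have : (3 : ℝ) ≤ m := by exact_mod_cast hm2
      nlinarith [Real.pi_pos]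
    have hsin : Real.sin φ ≠ 0 := (Real.sin_pos_of_pos_of_lt_pi hφ0 hφπ).ne'
    rw [ht]
    rcases Nat.even_or_odd' m with ⟨k, rfl | rfl⟩
    · have e1 : (((2 * k : ℕ) : ℤ) - 2) / 2 = k - 1 := by push_cast; omega
      have e2 : (((2 * k : ℕ) : ℤ) - 1) / 2 = k - 1 := by push_cast; omega
      have hS : (S ℝ ((k : ℤ) - 1)).eval (2 * Real.cos φ) = 0 := by
        have h := S_two_mul_real_cos φ ((k : ℤ) - 1)
        have hk : ((((k : ℤ) - 1 : ℤ) : ℝ) + 1) * φ = Real.pi := by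
          push_cast at hmφ ⊢
          linarith
        rw [hk, Real.sin_pi] at h
        exact (mul_eq_zero.mp h).resolve_right hsin
      rw [e1, e2, hS]
      simp
    · have e1 : (((2 * k + 1 : ℕ) : ℤ) - 2) / 2 = k - 1 := by push_cast; omega
      have e2 : (((2 * k + 1 : ℕ) : ℤ) - 1) / 2 = k := by push_cast; omega
      have e3 : (((2 * k + 1 : ℕ) : ℤ) - 3) / 2 = k - 1 := by push_cast; omega
      have e4 : ((2 * k + 1 : ℕ) : ℤ) / 2 = k := by push_cast; omega
      have hS : (S ℝ (k : ℤ)).eval (2 * Real.cos φ) +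
          (S ℝ ((k : ℤ) - 1)).eval (2 * Real.cos φ) = 0 := by
        have h := S_two_mul_real_cos φ (k : ℤ)
        have h' := S_two_mul_real_cos φ ((k : ℤ) - 1)
        have hk : (((k : ℤ) : ℝ) + 1) * φ = 2 * Real.pi - k * φ := by
          push_cast at hmφ ⊢
          linarith
        have hk' : ((((k : ℤ) - 1 : ℤ) : ℝ) + 1) * φ = k * φ := by push_cast; ring
        rw [hk, Real.sin_two_pi_sub] at h
        rw [hk'] at h'
        refine (mul_eq_zero.mp (?_ : _ * Real.sin φ = 0)).resolve_right hsin
        rw [add_mul, h, h']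
        ring
      rw [e1, e2, e3, e4, hS]
      simp

/-- The geometric representation of the Coxeter group. -/
def geom {B : Type*} (M : CoxeterMatrix B) : M.Group →* ((B →₀ ℝ) ≃ₗ[ℝ] (B →₀ ℝ)) :=
  M.toCoxeterSystem.lift ⟨simpleReflection M, simpleReflection_isLiftable M⟩

theorem geom_simple {B : Type*} (M : CoxeterMatrix B) (s : B) (v : B →₀ ℝ) :
    geom M (M.simple s) v = v - coroot M s v • root s := by
  have h := M.toCoxeterSystem.lift_apply_simple (simpleReflection_isLiftable M) s
  rw [← simpleReflection_apply, ← h]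
  rfl

theorem geom_mul {B : Type*} (M : CoxeterMatrix B) (u w : M.Group) (v : B →₀ ℝ) :
    geom M (u * w) v = geom M u (geom M w v) := by
  rw [map_mul, LinearEquiv.mul_apply]

theorem geom_one {B : Type*} (M : CoxeterMatrix B) (v : B →₀ ℝ) : geom M 1 v = v := by
  rw [map_one, LinearEquiv.coe_one, id]

theorem geom_simple_root {B : Type*} (M : CoxeterMatrix B) (s : B) :
    geom M (M.simple s) (root s) = -root s := by
  rw [geom_simple, coroot_root_self, two_smul]
  abel

theorem geom_mul_simple_root {B : Type*} (M : CoxeterMatrix B) (w : M.Group) (s : B) :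
    geom M (w * M.simple s) (root s) = -geom M w (root s) := by
  rw [geom_mul, geom_simple_root, map_neg]

theorem geom_inv_geom {B : Type*} (M : CoxeterMatrix B) (w : M.Group) (v : B →₀ ℝ) :
    geom M w⁻¹ (geom M w v) = v := by
  rw [← geom_mul, inv_mul_cancel, geom_one]

theorem geom_geom_inv {B : Type*} (M : CoxeterMatrix B) (w : M.Group) (v : B →₀ ℝ) :
    geom M w (geom M w⁻¹ v) = v := by
  rw [← geom_mul, mul_inv_cancel, geom_one]

theorem simple_mul_self {B : Type*} (M : CoxeterMatrix B) (s : B) :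
    M.simple s * M.simple s = 1 :=
  M.toCoxeterSystem.simple_mul_simple_self s

theorem simple_inv {B : Type*} (M : CoxeterMatrix B) (s : B) : (M.simple s)⁻¹ = M.simple s :=
  M.toCoxeterSystem.inv_simple s

/-! ### Positivity of roots -/

/-- The coefficients of the roots of a dihedral group, where `c` is minus the value of a simple
coroot at the other simple root. -/
def dihedralCoeff (c : ℝ) : ℕ → ℝ
  | 0 => 0
  | 1 => 1
  | k + 2 => c * dihedralCoeff c (k + 1) - dihedralCoeff c k

theorem dihedralCoeff_mul_sin (θ : ℝ) (k : ℕ) :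
    dihedralCoeff (2 * Real.cos θ) k * Real.sin θ = Real.sin (k * θ) := by
  induction k using Nat.twoStepInduction with
  | zero => simp [dihedralCoeff]
  | one => simp [dihedralCoeff]
  | more k h0 h1 =>
    have e0 : (k : ℝ) * θ = ((k + 1 : ℕ) : ℝ) * θ - θ := by push_cast; ring
    have e2 : ((k + 2 : ℕ) : ℝ) * θ = ((k + 1 : ℕ) : ℝ) * θ + θ := by push_cast; ring
    rw [e0, Real.sin_sub] at h0
    rw [e2, Real.sin_add, dihedralCoeff, sub_mul, mul_assoc, h1, h0]
    ring

theorem dihedralCoeff_two (k : ℕ) : dihedralCoeff 2 k = k := by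
  induction k using Nat.twoStepInduction with
  | zero => simp [dihedralCoeff]
  | one => simp [dihedralCoeff]
  | more k h0 h1 =>
    rw [dihedralCoeff, h0, h1]
    push_cast
    ring

/-- With `θ = π/m` the coefficient is `sin(kθ)/sin θ`, and `kθ ≤ π`. For `m = 0` (infinity) the
convention `π/0 = 0` gives `c = 2`, where the coefficient is `k`. -/
theorem dihedralCoeff_nonneg {m k : ℕ} (hm : m ≠ 1) (hk : m = 0 ∨ k ≤ m) :
    0 ≤ dihedralCoeff (2 * Real.cos (Real.pi / m)) k := by
  rcases hk with rfl | hk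
  · simp [dihedralCoeff_two]
  rcases Nat.eq_zero_or_pos m with rfl | hpos
  · simp [dihedralCoeff_two]
  have hm0 : (0 : ℝ) < m := by exact_mod_cast hpos
  have h2 : (2 : ℝ) ≤ m := by exact_mod_cast (by omega : 2 ≤ m)
  have hsin : 0 < Real.sin (Real.pi / m) := by
    apply Real.sin_pos_of_pos_of_lt_pi (by positivity)
    rw [div_lt_iff₀ hm0]
    nlinarith [Real.pi_pos]
  refine nonneg_of_mul_nonneg_left (b := Real.sin (Real.pi / m)) ?_ hsin
  rw [dihedralCoeff_mul_sin]
  apply Real.sin_nonneg_of_nonneg_of_le_pi (by positivity)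
  rw [← mul_div_assoc, div_le_iff₀ hm0, mul_comm]
  exact mul_le_mul_of_nonneg_left (by exact_mod_cast hk) Real.pi_pos.le

/-- The alternating product of `k` simple reflections at `s` and `t`, ending with `t`. -/
def altProd {B : Type*} (M : CoxeterMatrix B) (s t : B) (k : ℕ) : M.Group :=
  M.toCoxeterSystem.wordProd (CoxeterSystem.alternatingWord s t k)

theorem altProd_zero {B : Type*} (M : CoxeterMatrix B) (s t : B) : altProd M s t 0 = 1 := by
  simp [altProd, CoxeterSystem.alternatingWord]

theorem altProd_succ {B : Type*} (M : CoxeterMatrix B) (s t : B) (k : ℕ) :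
    altProd M s t (k + 1) = altProd M t s k * M.simple t := by
  rw [altProd, CoxeterSystem.alternatingWord_succ, CoxeterSystem.wordProd_concat]
  rfl

theorem altProd_succ' {B : Type*} (M : CoxeterMatrix B) (s t : B) (k : ℕ) :
    altProd M s t (k + 1) = M.simple (if Even k then t else s) * altProd M s t k := by
  rw [altProd, CoxeterSystem.alternatingWord_succ', CoxeterSystem.wordProd_cons]
  rfl

theorem len_altProd_le {B : Type*} (M : CoxeterMatrix B) (s t : B) (k : ℕ) :
    len M (altProd M s t k) ≤ k :=
  (M.toCoxeterSystem.length_wordProd_le _).trans_eq (CoxeterSystem.length_alternatingWord s t k)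

theorem altProd_braid {B : Type*} (M : CoxeterMatrix B) (s t : B) :
    altProd M s t (M s t) = altProd M t s (M s t) := by
  have h := M.toCoxeterSystem.wordProd_braidWord_eq s t
  rw [CoxeterSystem.braidWord, CoxeterSystem.braidWord, M.symmetric t s] at h
  exact h

/-- The recurrence defining `dihedralCoeff` is the effect of one further reflection on the pair of
coordinates. -/
theorem geom_altProd_root {B : Type*} (M : CoxeterMatrix B) (s t : B) (k : ℕ) :
    geom M (altProd M s t k) (root s) =
      dihedralCoeff (2 * Real.cos (Real.pi / M s t)) (k + 1) • root (if Even k then s else t) +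
      dihedralCoeff (2 * Real.cos (Real.pi / M s t)) k • root (if Even k then t else s) := by
  induction k with
  | zero => simp [altProd_zero, dihedralCoeff]
  | succ k ih =>
    rw [altProd_succ', geom_mul, ih, map_add, map_smul, map_smul, dihedralCoeff]
    by_cases h : Even k
    · have h' : ¬ Even (k + 1) := by simpa [Nat.even_add_one] using h
      simp only [h, h', if_true, if_false, geom_simple, coroot_root, M.diagonal,
        M.symmetric t s, Nat.cast_one, div_one, Real.cos_pi]
      module
    · have h' : Even (k + 1) := by simpa [Nat.even_add_one] using h
      simp only [h, h', if_true, if_false, geom_simple, coroot_root, M.diagonal,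
        Nat.cast_one, div_one, Real.cos_pi]
      module

theorem len_mul_le {B : Type*} (M : CoxeterMatrix B) (u w : M.Group) :
    len M (u * w) ≤ len M u + len M w :=
  M.toCoxeterSystem.length_mul_le u w

theorem len_one {B : Type*} (M : CoxeterMatrix B) : len M 1 = 0 :=
  M.toCoxeterSystem.length_one

theorem len_inv {B : Type*} (M : CoxeterMatrix B) (w : M.Group) : len M w⁻¹ = len M w :=
  M.toCoxeterSystem.length_inv w

theorem len_eq_zero_iff {B : Type*} (M : CoxeterMatrix B) {w : M.Group} :
    len M w = 0 ↔ w = 1 :=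
  M.toCoxeterSystem.length_eq_zero_iff

theorem len_mul_simple {B : Type*} (M : CoxeterMatrix B) (w : M.Group) (s : B) :
    len M (w * M.simple s) = len M w + 1 ∨ len M (w * M.simple s) + 1 = len M w :=
  M.toCoxeterSystem.length_mul_simple w s

theorem exists_len_mul_simple_lt {B : Type*} (M : CoxeterMatrix B) {w : M.Group} (hw : w ≠ 1) :
    ∃ s, len M (w * M.simple s) < len M w :=
  M.toCoxeterSystem.exists_rightDescent_of_ne_one hw

theorem mul_simple_mul_simple {B : Type*} (M : CoxeterMatrix B) (w : M.Group) (s : B) :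
    w * M.simple s * M.simple s = w := by
  rw [mul_assoc, simple_mul_self, mul_one]

/-- The roots `w α_s` with `ℓ(w s) > ℓ(w)` are positive. -/
theorem geom_root_nonneg {B : Type*} (M : CoxeterMatrix B) (w : M.Group) (s : B)
    (h : len M w < len M (w * M.simple s)) : 0 ≤ geom M w (root s) := by
  classical
  induction hn : len M w using Nat.strong_induction_on generalizing w s with
  | _ n ih =>
  subst hn
  rcases eq_or_ne w 1 with rfl | hw
  · rw [geom_one]
    exact Finsupp.single_nonneg.mpr zero_le_one
  obtain ⟨t, ht⟩ := exists_len_mul_simple_lt M hw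
  have hst : s ≠ t := by rintro rfl; omega
  -- `P k` says that the alternating word of length `k` ending in `t` splits off `w` on the right
  -- with lengths adding. The largest initial run of such `k` makes the remaining factor `v` minimal
  -- in its coset of the dihedral subgroup.
  let P : ℕ → Prop := fun k => len M (w * (altProd M s t k)⁻¹) + k = len M w
  have hP : ∃ k, ¬ P (k + 1) := ⟨len M w, fun hk => by
    change _ + _ = _ at hk; omega⟩
  set k := Nat.find hP
  have hPk : ¬ P (k + 1) := Nat.find_spec hP
  have hPle : ∀ j, j ≤ k → P j := by
    intro j hj
    rcases j with _ | j
    · simp [P, altProd_zero]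
    · exact not_not.mp (Nat.find_min hP (m := j) (by omega))
  have hP1 : P 1 := by
    have := len_mul_simple M w t
    simp only [P, altProd_succ, altProd_zero, one_mul, simple_inv]
    omega
  have hk1 : 1 ≤ k := by
    by_contra h0
    have h0 : k = 0 := by omega
    rw [h0] at hPk
    exact hPk hP1
  -- Were a full braid word split off, the braid relation would rewrite it to end in `s`,
  -- contradicting `ℓ(w s) > ℓ(w)`.
  have hkm : M s t = 0 ∨ k < M s t := by
    by_contra! hcon
    obtain ⟨hm0, hmk⟩ := hcon
    have hPm : len M (w * (altProd M s t (M s t))⁻¹) + M s t = len M w := hPle _ hmk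
    obtain ⟨m, hm⟩ := Nat.exists_eq_succ_of_ne_zero hm0
    have e : w * M.simple s = (w * (altProd M s t (M s t))⁻¹) * altProd M s t m := by
      rw [altProd_braid, hm, Nat.succ_eq_add_one, altProd_succ, mul_inv_rev, simple_inv]
      group
    have h1 := len_mul_le M (w * (altProd M s t (M s t))⁻¹) (altProd M s t m)
    have h2 := len_altProd_le M s t m
    rw [← e] at h1
    omega
  set v := w * (altProd M s t k)⁻¹ with hv
  have hvlen : len M v + k = len M w := hPle k le_rfl
  have hwv : w = v * altProd M s t k := by rw [hv]; group
  -- One of the two letters would extend the alternating word, which fails by maximality of `k`; the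
  -- other is the first letter of the word split off.
  have key : ∀ r, r = s ∨ r = t → len M v < len M (v * M.simple r) := by
    intro r hr
    obtain ⟨j, hj⟩ := Nat.exists_eq_succ_of_ne_zero (by omega : k ≠ 0)
    have hcases : r = (if Even k then t else s) ∨ r = (if Even j then t else s) := by
      simp only [hj, Nat.succ_eq_add_one, Nat.even_add_one]
      by_cases hje : Even j <;> simp [hje] <;> tauto
    rcases hcases with hr' | hr'
    · have hnot : len M (w * (altProd M s t (k + 1))⁻¹) + (k + 1) ≠ len M w := hPk
      rw [altProd_succ', mul_inv_rev, simple_inv, ← mul_assoc, ← hv, ← hr'] at hnot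
      have := len_mul_simple M v r
      omega
    · have hPj : len M (w * (altProd M s t j)⁻¹) + j = len M w := hPle j (by omega)
      have e : w * (altProd M s t j)⁻¹ = v * M.simple r := by
        rw [hv, hj, Nat.succ_eq_add_one, altProd_succ', mul_inv_rev, ← hr']
        group
      rw [e] at hPj
      omega
  have hpos : ∀ r, r = s ∨ r = t → 0 ≤ geom M v (root r) := fun r hr =>
    ih (len M v) (by omega) v r (key r hr) rfl
  have hm1 : M s t ≠ 1 := M.off_diagonal s t hst
  rw [hwv, geom_mul, geom_altProd_root, map_add, map_smul, map_smul]
  refine add_nonneg (smul_nonneg (dihedralCoeff_nonneg hm1 (by omega)) (hpos _ ?_))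
    (smul_nonneg (dihedralCoeff_nonneg hm1 (by omega)) (hpos _ ?_))
  · split_ifs <;> simp
  · split_ifs <;> simp

theorem geom_root_ne_zero {B : Type*} (M : CoxeterMatrix B) (w : M.Group) (s : B) :
    geom M w (root s) ≠ 0 := by
  intro h
  rw [LinearEquiv.map_eq_zero_iff, Finsupp.single_eq_zero] at h
  exact one_ne_zero h

theorem geom_root_nonpos {B : Type*} (M : CoxeterMatrix B) (w : M.Group) (s : B)
    (h : len M (w * M.simple s) < len M w) : geom M w (root s) ≤ 0 := by
  have h1 := geom_root_nonneg M (w * M.simple s) s (by rwa [mul_simple_mul_simple])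
  rw [geom_mul_simple_root] at h1
  exact neg_nonneg.mp h1

theorem geom_root_nonneg_or_nonpos {B : Type*} (M : CoxeterMatrix B) (w : M.Group) (s : B) :
    0 ≤ geom M w (root s) ∨ geom M w (root s) ≤ 0 := by
  rcases len_mul_simple M w s with h | h
  · exact Or.inl (geom_root_nonneg M w s (by omega))
  · exact Or.inr (geom_root_nonpos M w s (by omega))

theorem geom_root_nonneg_iff {B : Type*} (M : CoxeterMatrix B) (w : M.Group) (s : B) :
    0 ≤ geom M w (root s) ↔ len M w < len M (w * M.simple s) := by
  refine ⟨fun h => ?_, geom_root_nonneg M w s⟩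
  rcases len_mul_simple M w s with h' | h'
  · omega
  · exact absurd (le_antisymm (geom_root_nonpos M w s (by omega)) h) (geom_root_ne_zero M w s)

/-- A nontrivial element has a right descent, which it sends to a negative root. This yields
faithfulness and lets identities in the group be verified on simple roots. -/
theorem eq_one_of_geom_root_nonneg {B : Type*} (M : CoxeterMatrix B) {w : M.Group}
    (h : ∀ s, 0 ≤ geom M w (root s)) : w = 1 := by
  by_contra hw
  obtain ⟨s, hs⟩ := exists_len_mul_simple_lt M hw
  have := (geom_root_nonneg_iff M w s).mp (h s)
  omega

/-- A positive multiple of a simple root in the orbit of a simple root witnesses that the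
corresponding reflections are conjugate. -/
theorem mul_simple_eq_simple_mul {B : Type*} (M : CoxeterMatrix B) {w : M.Group} {s t : B}
    (hpos : 0 ≤ geom M w (root t)) (h : ∀ b, b ≠ s → geom M w (root t) b = 0) :
    w * M.simple t = M.simple s * w := by
  set c := geom M w (root t) s with hc
  have hβ : geom M w (root t) = c • root s := by
    ext b
    rcases eq_or_ne b s with rfl | hb
    · simp [hc]
    · rw [h b hb, Finsupp.smul_apply, Finsupp.single_eq_of_ne hb, smul_zero]
  have hc0 : 0 < c := by
    refine lt_of_le_of_ne (hpos s) fun h0 => geom_root_ne_zero M w t ?_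
    rw [hβ, ← h0, zero_smul]
  have hα : geom M w⁻¹ (root s) = c⁻¹ • root t := by
    rw [← geom_inv_geom M w (root t), hβ, map_smul, smul_smul, inv_mul_cancel₀ hc0.ne', one_smul]
  -- Both `s` and `w t w⁻¹` move vectors along `α_s` only, so their product changes only the
  -- coordinate at `s`. It fixes `α_s` whatever the scalar `c` is, so `c = 1` need not be shown.
  have hz : M.simple s * w * M.simple t * w⁻¹ = 1 := by
    apply eq_one_of_geom_root_nonneg M
    intro b
    have e : geom M (M.simple s * w * M.simple t * w⁻¹) (root b) =
        root b + (coroot M t (geom M w⁻¹ (root b)) * c - coroot M s (root b)) • root s := by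
      rw [geom_mul, geom_mul, geom_simple, geom_mul, map_sub, map_sub, geom_geom_inv, map_smul,
        map_smul, hβ, map_smul, geom_simple_root, geom_simple]
      module
    rcases eq_or_ne b s with rfl | hb
    · rw [e, hα, map_smul, coroot_root_self, coroot_root_self, smul_eq_mul, mul_right_comm,
        inv_mul_cancel₀ hc0.ne', one_mul, sub_self, zero_smul, add_zero]
      exact Finsupp.single_nonneg.mpr zero_le_one
    -- The coordinate at `b ≠ s` is still 1, so the root cannot be negative.
    · refine (geom_root_nonneg_or_nonpos M _ b).resolve_right fun hneg => ?_
      have := hneg b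
      rw [e] at this
      simp [Finsupp.single_eq_of_ne hb] at this
      norm_num at this
  have h1 := mul_eq_one_iff_eq_inv.mp hz
  rw [inv_inv] at h1
  calc w * M.simple t = M.simple s * (M.simple s * w * M.simple t) := by
        rw [← mul_assoc, ← mul_assoc, simple_mul_self, one_mul]
    _ = M.simple s * w := by rw [h1]

theorem geom_nonneg_of_support {B : Type*} (M : CoxeterMatrix B) {w : M.Group} {X : Set B}
    (h : ∀ s ∈ X, 0 ≤ geom M w (root s)) {v : B →₀ ℝ} (hv : 0 ≤ v) (hX : ∀ b, b ∉ X → v b = 0) :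
    0 ≤ geom M w v := by
  rw [← Finsupp.sum_single v, Finsupp.sum, map_sum]
  refine Finset.sum_nonneg fun b hb => ?_
  have hbX : b ∈ X := by
    by_contra hcon
    exact Finsupp.mem_support_iff.mp hb (hX b hcon)
  rw [← mul_one (v b), ← smul_eq_mul, ← Finsupp.smul_single, map_smul]
  exact smul_nonneg (hv b) (h b hbX)

/-! ### Standard parabolic subgroups -/

theorem simple_mem_parabolic {B : Type*} (M : CoxeterMatrix B) {X : Set B} {s : B} (hs : s ∈ X) :
    M.simple s ∈ parabolic M X :=
  Subgroup.subset_closure ⟨s, hs, rfl⟩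

theorem parabolic_mono {B : Type*} (M : CoxeterMatrix B) {X Y : Set B} (h : X ⊆ Y) :
    parabolic M X ≤ parabolic M Y :=
  Subgroup.closure_mono (Set.image_mono h)

theorem parabolic_empty {B : Type*} (M : CoxeterMatrix B) : parabolic M ∅ = ⊥ := by
  simp [parabolic]

theorem parabolic_univ {B : Type*} (M : CoxeterMatrix B) : parabolic M Set.univ = ⊤ := by
  rw [parabolic, Set.image_univ]
  exact M.toCoxeterSystem.subgroup_closure_range_simple

theorem range_groupIncl {A B : Type*} (M : CoxeterMatrix B) (f : A ↪ B) :
    (groupIncl M f).range = parabolic M (Set.range f) := by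
  rw [MonoidHom.range_eq_map, ← parabolic_univ, map_parabolic, Set.image_univ]

/-- A generator `s ∈ X` subtracts a multiple of `α_s`, hence touches only the coordinate at `s`. -/
theorem geom_parabolic_apply {B : Type*} (M : CoxeterMatrix B) {X : Set B} {w : M.Group}
    (hw : w ∈ parabolic M X) (v : B →₀ ℝ) {b : B} (hb : b ∉ X) : geom M w v b = v b := by
  induction hw using Subgroup.closure_induction generalizing v with
  | mem x hx =>
    obtain ⟨s, hs, rfl⟩ := hx
    have : b ≠ s := by rintro rfl; exact hb hs
    rw [geom_simple, Finsupp.sub_apply, Finsupp.smul_apply, Finsupp.single_eq_of_ne this,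
      smul_zero, sub_zero]
  | one => rw [geom_one]
  | mul x y _ _ hx hy => rw [geom_mul, hx, hy]
  | inv x _ hx => rw [← hx, geom_geom_inv]

theorem simple_mem_parabolic_iff {B : Type*} (M : CoxeterMatrix B) {X : Set B} {s : B} :
    M.simple s ∈ parabolic M X ↔ s ∈ X := by
  refine ⟨fun h => ?_, simple_mem_parabolic M⟩
  by_contra hs
  have := geom_parabolic_apply M h (root s) hs
  rw [geom_simple_root] at this
  simp at this
  norm_num at this

/-- If a conjugate `w⁻¹ t w` of a simple reflection lies in `W_X`, then the root `w⁻¹ α_t` is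
supported on `X`. -/
theorem geom_inv_root_apply_eq_zero {B : Type*} (M : CoxeterMatrix B) {X : Set B} {w : M.Group}
    {t : B} (h : w⁻¹ * M.simple t * w ∈ parabolic M X) {b : B} (hb : b ∉ X) :
    geom M w⁻¹ (root t) b = 0 := by
  -- The reflection `w⁻¹ t w` negates `w⁻¹ α_t` yet preserves its coordinates outside `X`, so these
  -- vanish.
  have := geom_parabolic_apply M h (geom M w⁻¹ (root t)) hb
  rw [geom_mul, geom_mul, geom_geom_inv, geom_simple_root, map_neg, Finsupp.neg_apply] at this
  linarith

/-! ### The inclusion of the Coxeter group of a full subgraph -/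

/-- The inclusion of the spaces of the geometric representations. -/
abbrev rootIncl {A B : Type*} (f : A ↪ B) : (A →₀ ℝ) →ₗ[ℝ] (B →₀ ℝ) :=
  Finsupp.lmapDomain ℝ ℝ f

theorem rootIncl_apply {A B : Type*} (f : A ↪ B) (v : A →₀ ℝ) (a : A) :
    rootIncl f v (f a) = v a :=
  Finsupp.mapDomain_apply f.injective v a

theorem rootIncl_notMem {A B : Type*} (f : A ↪ B) (v : A →₀ ℝ) {b : B} (hb : b ∉ Set.range f) :
    rootIncl f v b = 0 :=
  Finsupp.mapDomain_of_notMem_range v b hb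

theorem rootIncl_root {A B : Type*} (f : A ↪ B) (a : A) :
    rootIncl f (root a) = root (f a) :=
  Finsupp.mapDomain_single

theorem rootIncl_nonneg {A B : Type*} (f : A ↪ B) {v : A →₀ ℝ} :
    0 ≤ rootIncl f v ↔ 0 ≤ v := by
  constructor
  · intro h a
    rw [← rootIncl_apply f v a]
    exact h (f a)
  · intro h b
    by_cases hb : b ∈ Set.range f
    · obtain ⟨a, rfl⟩ := hb
      rw [rootIncl_apply]
      exact h a
    · rw [rootIncl_notMem f v hb]
      exact le_rfl

theorem coroot_rootIncl {A B : Type*} (M : CoxeterMatrix B) (f : A ↪ B) (a : A) (v : A →₀ ℝ) :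
    coroot M (f a) (rootIncl f v) = coroot (restrict M f) a v := by
  induction v using Finsupp.induction_linear with
  | zero => simp
  | add v w hv hw => rw [map_add, map_add, map_add, hv, hw]
  | single b r =>
    rw [← mul_one r, ← smul_eq_mul, ← Finsupp.smul_single, map_smul, map_smul, map_smul,
      rootIncl_root, coroot_root, coroot_root]
    rfl

theorem geom_groupIncl {A B : Type*} (M : CoxeterMatrix B) (f : A ↪ B)
    (x : (restrict M f).Group) (v : A →₀ ℝ) :
    geom M (groupIncl M f x) (rootIncl f v) = rootIncl f (geom (restrict M f) x v) := by
  induction x using (restrict M f).toCoxeterSystem.simple_induction_left with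
  | one => rw [map_one, geom_one, geom_one]
  | mul_simple_left w i ih =>
    change geom M (groupIncl M f ((restrict M f).simple i * w)) _ =
      rootIncl f (geom _ ((restrict M f).simple i * w) v)
    rw [map_mul, geom_mul, geom_mul, ih, groupIncl_simple, geom_simple, geom_simple, map_sub,
      map_smul, rootIncl_root, coroot_rootIncl]

theorem geom_groupIncl_root {A B : Type*} (M : CoxeterMatrix B) (f : A ↪ B)
    (x : (restrict M f).Group) (a : A) :
    geom M (groupIncl M f x) (root (f a)) = rootIncl f (geom (restrict M f) x (root a)) := by
  rw [← rootIncl_root, geom_groupIncl]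

/-- The inclusion of root spaces intertwines the two representations, so an element of the kernel
fixes all simple roots of the subgraph. -/
theorem groupIncl_injective {A B : Type*} (M : CoxeterMatrix B) (f : A ↪ B) :
    Function.Injective (groupIncl M f) := by
  rw [injective_iff_map_eq_one]
  intro x hx
  apply eq_one_of_geom_root_nonneg
  intro a
  rw [← rootIncl_nonneg f, ← geom_groupIncl_root, hx, geom_one]
  exact Finsupp.single_nonneg.mpr zero_le_one

/-- Build `x` letter by letter: if `y a` is longer than `y`, then `y α_a` is a nonnegative
combination of simple roots of the subgraph. By hypothesis `w` keeps it nonnegative, so the length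
of `w y` also grows. -/
theorem len_mul_groupIncl {A B : Type*} (M : CoxeterMatrix B) (f : A ↪ B) {w : M.Group}
    (hw : ∀ a, 0 ≤ geom M w (root (f a))) (x : (restrict M f).Group) :
    len M (w * groupIncl M f x) = len M w + len (restrict M f) x := by
  induction hn : len (restrict M f) x generalizing x with
  | zero =>
    rw [len_eq_zero_iff] at hn
    rw [hn, map_one, mul_one, add_zero]
  | succ n ih =>
    have hx1 : x ≠ 1 := by
      rintro rfl
      rw [len_one] at hn
      omega
    obtain ⟨a, ha⟩ := exists_len_mul_simple_lt _ hx1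
    set y := x * (restrict M f).simple a with hy
    have hxy : x = y * (restrict M f).simple a := by rw [hy, mul_simple_mul_simple]
    have hyn : len (restrict M f) y = n := by
      have := len_mul_simple (restrict M f) x a
      rw [← hy] at this
      omega
    have h1 := ih y hyn
    have hpos : 0 ≤ geom M (w * groupIncl M f y) (root (f a)) := by
      rw [geom_mul, geom_groupIncl_root]
      refine geom_nonneg_of_support M (X := Set.range f) ?_ ?_
        fun b hb => rootIncl_notMem f _ hb
      · rintro _ ⟨a, rfl⟩
        exact hw a
      · rw [rootIncl_nonneg, geom_root_nonneg_iff, ← hxy]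
        omega
    have h2 := (geom_root_nonneg_iff M _ _).mp hpos
    have h3 := len_mul_simple M (w * groupIncl M f y) (f a)
    rw [hxy, map_mul, groupIncl_simple, ← mul_assoc]
    omega

/-! ### Reduced elements -/

/-- Being no longer than its neighbours `w s`, `s ∈ X`, already forces minimality in all of `w W_X`,
because lengths add there. -/
theorem isDoubleReduced_empty_left_iff {B : Type*} (M : CoxeterMatrix B) {X : Set B}
    {w : M.Group} :
    IsDoubleReduced M ∅ X w ↔ ∀ s ∈ X, 0 ≤ geom M w (root s) := by
  constructor
  · intro h s hs
    have h1 := h (w * M.simple s) (DoubleCoset.mem_doubleCoset.mpr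
      ⟨1, one_mem _, M.simple s, simple_mem_parabolic M hs, by rw [one_mul]⟩)
    have h2 := len_mul_simple M w s
    rw [geom_root_nonneg_iff]
    omega
  · intro h v hv
    obtain ⟨a, ha, x, hx, rfl⟩ := DoubleCoset.mem_doubleCoset.mp hv
    rw [parabolic_empty] at ha
    obtain rfl : a = 1 := ha
    have hr : parabolic M X = (groupIncl M (incl X)).range := by
      rw [range_groupIncl]
      simp
    rw [hr] at hx
    obtain ⟨x, rfl⟩ := hx
    rw [one_mul, len_mul_groupIncl M (incl X) (fun a => h _ a.2)]
    omega

theorem isDoubleReduced_inv_iff {B : Type*} (M : CoxeterMatrix B) {X Y : Set B} {w : M.Group} :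
    IsDoubleReduced M X Y w⁻¹ ↔ IsDoubleReduced M Y X w := by
  have key : ∀ (X Y : Set B) (w : M.Group), IsDoubleReduced M X Y w →
      IsDoubleReduced M Y X w⁻¹ := by
    intro X Y w h v hv
    obtain ⟨a, ha, b, hb, rfl⟩ := DoubleCoset.mem_doubleCoset.mp hv
    rw [len_inv, ← len_inv M (a * w⁻¹ * b)]
    exact h _ (DoubleCoset.mem_doubleCoset.mpr
      ⟨b⁻¹, inv_mem hb, a⁻¹, inv_mem ha, by group⟩)
  refine ⟨fun h => ?_, key Y X w⟩
  rw [← inv_inv w]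
  exact key _ _ _ h

theorem isDoubleReduced_empty_right_iff {B : Type*} (M : CoxeterMatrix B) {X : Set B}
    {w : M.Group} :
    IsDoubleReduced M X ∅ w ↔ ∀ s ∈ X, 0 ≤ geom M w⁻¹ (root s) := by
  rw [← isDoubleReduced_empty_left_iff, isDoubleReduced_inv_iff]

theorem len_groupIncl_mul {A B : Type*} (M : CoxeterMatrix B) (f : A ↪ B) {w : M.Group}
    (hw : IsDoubleReduced M (Set.range f) ∅ w) (x : (restrict M f).Group) :
    len M (groupIncl M f x * w) = len (restrict M f) x + len M w := by
  rw [isDoubleReduced_empty_right_iff] at hw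
  rw [← len_inv, mul_inv_rev, ← map_inv, len_mul_groupIncl M f (fun a => hw _ ⟨a, rfl⟩),
    len_inv, len_inv, add_comm]

/-! ### The decomposition `u = u₀ u₁` and the projection -/

theorem existsUnique_isDecomposition {A B : Type*} (M : CoxeterMatrix B) (f : A ↪ B)
    (u : M.Group) : ∃! d, IsDecomposition M f u d := by
  let F : (restrict M f).Group → ℕ := fun x => len M (groupIncl M f x * u)
  set x := Function.argmin F
  refine ⟨(x⁻¹, groupIncl M f x * u), ⟨by rw [map_inv, inv_mul_cancel_left], ?_⟩, ?_⟩
  · intro v hv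
    obtain ⟨a, ha, b, hb, rfl⟩ := DoubleCoset.mem_doubleCoset.mp hv
    rw [parabolic_empty] at hb
    obtain rfl : b = 1 := hb
    rw [← range_groupIncl] at ha
    obtain ⟨a, rfl⟩ := ha
    rw [mul_one, ← mul_assoc, ← map_mul]
    exact Function.argmin_le F (a * x)
  · rintro ⟨u₀, u₁⟩ ⟨hu, hu₁⟩
    dsimp only at hu hu₁
    have h1 : F u₀⁻¹ = len M u₁ := by
      dsimp only [F]
      rw [hu, map_inv, inv_mul_cancel_left]
    have h2 : F x = len _ (x * u₀) + len M u₁ := by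
      rw [← len_groupIncl_mul M f hu₁, map_mul, mul_assoc, ← hu]
    have h3 : F x ≤ F u₀⁻¹ := Function.argmin_le F _
    -- Any decomposition gives `F x = ℓ(x u₀) + ℓ(u₁)` while `F u₀⁻¹ = ℓ(u₁)`; minimality of `x`
    -- leaves no room for `x u₀`.
    have h4 : x * u₀ = 1 := by
      rw [← len_eq_zero_iff]
      omega
    obtain rfl : u₀ = x⁻¹ := eq_inv_of_mul_eq_one_right h4
    rw [hu, map_inv, mul_inv_cancel_left]

/-- The set of the `a` such that the simple reflection at `f a` lies in `w W_X w⁻¹`. -/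
def conjTrace {A B : Type*} (M : CoxeterMatrix B) (f : A ↪ B) (w : M.Group) (X : Set B) : Set A :=
  {a | w⁻¹ * M.simple (f a) * w ∈ parabolic M X}

theorem conjTrace_eq {A B : Type*} (M : CoxeterMatrix B) (f : A ↪ B) (w : M.Group) (X : Set B) :
    conjTrace M f w X = {t | ∃ x ∈ parabolic M X, M.simple (f t) = w * x * w⁻¹} := by
  ext t
  constructor
  · intro h
    exact ⟨_, h, by group⟩
  · rintro ⟨x, hx, h⟩
    change w⁻¹ * M.simple (f t) * w ∈ parabolic M X
    rw [h]
    convert hx using 1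
    group

theorem conj_groupIncl_mem {A B : Type*} (M : CoxeterMatrix B) (f : A ↪ B) {w : M.Group}
    {X : Set B} {x : (restrict M f).Group}
    (hx : x ∈ parabolic (restrict M f) (conjTrace M f w X)) :
    w⁻¹ * groupIncl M f x * w ∈ parabolic M X := by
  have h : parabolic (restrict M f) (conjTrace M f w X) ≤
      (parabolic M X).comap ((MulAut.conj w⁻¹).toMonoidHom.comp (groupIncl M f)) := by
    rw [parabolic, Subgroup.closure_le]
    rintro _ ⟨a, ha, rfl⟩
    simpa [groupIncl_simple] using (show w⁻¹ * M.simple (f a) * w ∈ parabolic M X from ha)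
  simpa using h hx

/-- Conjugation by `w⁻¹` embeds the parabolic subgroup on the trace into the finite group `W_X`. -/
theorem conjTrace_mem_spherical {A B : Type*} (M : CoxeterMatrix B) (f : A ↪ B) (w : M.Group)
    (X : Spherical M) : conjTrace M f w X ∈ Spherical (restrict M f) := by
  have hX : Finite (parabolic M (X : Set B)) := X.2
  refine Finite.of_injective (β := parabolic M (X : Set B))
    (fun x => ⟨w⁻¹ * groupIncl M f x * w, conj_groupIncl_mem M f x.2⟩) ?_
  intro x y h
  have h1 := congrArg Subtype.val h
  exact Subtype.ext (groupIncl_injective M f (mul_left_cancel (mul_right_cancel h1)))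

/-- If left multiplication by a simple reflection `t` increases the length of `v` and decreases
that of `v y` for some `y ∈ W_Y`, then `t` lies in `v W_Y v⁻¹`. -/
theorem conj_simple_mem_parabolic {B : Type*} (M : CoxeterMatrix B) {v y : M.Group} {Y : Set B}
    {t : B} (hv : 0 ≤ geom M v⁻¹ (root t)) (hy : y ∈ parabolic M Y)
    (hvy : geom M (v * y)⁻¹ (root t) ≤ 0) : v⁻¹ * M.simple t * v ∈ parabolic M Y := by
  -- Along a word for `y` the root `(v x)⁻¹ α_t` turns from positive to negative at some letter `s`.
  -- As `s` changes only the coordinate at `s`, that root is a multiple of `α_s`, and `v⁻¹ t v = x s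
  -- x⁻¹ ∈ W_Y`.
  have step : ∀ x ∈ parabolic M Y, ∀ s ∈ Y,
      (geom M (v * x)⁻¹ (root t) ≤ 0 → v⁻¹ * M.simple t * v ∈ parabolic M Y) →
      geom M (v * (x * M.simple s))⁻¹ (root t) ≤ 0 →
      v⁻¹ * M.simple t * v ∈ parabolic M Y := by
    intro x hx s hs ih hneg
    rcases geom_root_nonneg_or_nonpos M (v * x)⁻¹ t with h | h
    · rw [← mul_assoc, mul_inv_rev, simple_inv, geom_mul, geom_simple] at hneg
      have h1 := mul_simple_eq_simple_mul M (s := s) h fun b hb => by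
        have h2 := hneg b
        rw [Finsupp.sub_apply, Finsupp.smul_apply, Finsupp.single_eq_of_ne hb, smul_zero,
          sub_zero] at h2
        exact le_antisymm h2 (h b)
      have h3 : v⁻¹ * M.simple t * v = x * ((v * x)⁻¹ * M.simple t) * (v * x) * x⁻¹ := by group
      rw [h3, h1]
      have h4 : x * (M.simple s * (v * x)⁻¹) * (v * x) * x⁻¹ = x * M.simple s * x⁻¹ := by group
      rw [h4]
      exact mul_mem (mul_mem hx (simple_mem_parabolic M hs)) (inv_mem hx)
    · exact ih h
  induction hy using Subgroup.closure_induction_right with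
  | one =>
    rw [mul_one] at hvy
    exact absurd (le_antisymm hvy hv) (geom_root_ne_zero M _ _)
  | mul_right x hx y hy ih =>
    obtain ⟨s, hs, rfl⟩ := hy
    exact step x hx s hs ih hvy
  | mul_inv_cancel x hx y hy ih =>
    obtain ⟨s, hs, rfl⟩ := hy
    rw [simple_inv] at hvy
    exact step x hx s hs ih hvy

/-- A left descent `a` of `x` is one of `x u₁ = v₁ y`, since lengths add, but not of `v₁`. So `v₁⁻¹
a v₁ ∈ W_Y`, and the equation persists with `a x` for `x` and `v₁⁻¹ a v₁ y` for `y`. -/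
theorem mem_parabolic_conjTrace {A B : Type*} (M : CoxeterMatrix B) (f : A ↪ B)
    {v₁ u₁ y : M.Group} {Y : Set B} {x : (restrict M f).Group}
    (hv : IsDoubleReduced M (Set.range f) ∅ v₁) (hu : IsDoubleReduced M (Set.range f) ∅ u₁)
    (hy : y ∈ parabolic M Y) (h : v₁ * y = groupIncl M f x * u₁) :
    x ∈ parabolic (restrict M f) (conjTrace M f v₁ Y) := by
  induction hn : len (restrict M f) x using Nat.strong_induction_on generalizing x y with
  | _ n ih =>
  subst hn
  rcases eq_or_ne x 1 with rfl | hx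
  · exact one_mem _
  obtain ⟨a, ha⟩ := (restrict M f).toCoxeterSystem.exists_leftDescent_of_ne_one hx
  change len _ ((restrict M f).simple a * x) < len _ x at ha
  have hneg : geom M (v₁ * y)⁻¹ (root (f a)) ≤ 0 := by
    apply geom_root_nonpos
    have e : (v₁ * y)⁻¹ * M.simple (f a) =
        (groupIncl M f ((restrict M f).simple a * x) * u₁)⁻¹ := by
      rw [h, map_mul, groupIncl_simple, mul_assoc, mul_inv_rev (M.simple _), simple_inv]
    rw [e, len_inv, len_inv, h, len_groupIncl_mul M f hu, len_groupIncl_mul M f hu]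
    omega
  have hmem := conj_simple_mem_parabolic M
    ((isDoubleReduced_empty_right_iff M).mp hv (f a) ⟨a, rfl⟩) hy hneg
  have h' : v₁ * (v₁⁻¹ * M.simple (f a) * v₁ * y) =
      groupIncl M f ((restrict M f).simple a * x) * u₁ := by
    rw [map_mul, groupIncl_simple, mul_assoc (M.simple _), ← h]
    group
  have hrec := ih _ ha (mul_mem hmem hy) h' rfl
  have e : x = (restrict M f).simple a * ((restrict M f).simple a * x) := by
    rw [← mul_assoc, simple_mul_self, one_mul]
  rw [e]
  exact mul_mem (simple_mem_parabolic _ hmem) hrec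

/-- The decomposition `u = u₀ u₁` with `u₀ ∈ W_T` and `u₁` a `(T,∅)`-reduced element. -/
def decomposition {A B : Type*} (M : CoxeterMatrix B) (f : A ↪ B) (u : M.Group) :
    (restrict M f).Group × M.Group :=
  (existsUnique_isDecomposition M f u).choose

theorem isDecomposition_decomposition {A B : Type*} (M : CoxeterMatrix B) (f : A ↪ B)
    (u : M.Group) : IsDecomposition M f u (decomposition M f u) :=
  (existsUnique_isDecomposition M f u).choose_spec.1

theorem IsDecomposition.eq_decomposition {A B : Type*} {M : CoxeterMatrix B} {f : A ↪ B}
    {u : M.Group} {d : (restrict M f).Group × M.Group} (h : IsDecomposition M f u d) :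
    decomposition M f u = d :=
  (existsUnique_isDecomposition M f u).unique (isDecomposition_decomposition M f u) h

theorem isDecomposition_groupIncl {A B : Type*} (M : CoxeterMatrix B) (f : A ↪ B)
    (x : (restrict M f).Group) : IsDecomposition M f (groupIncl M f x) (x, 1) := by
  refine ⟨(mul_one _).symm, fun v _ => ?_⟩
  rw [len_one]
  exact Nat.zero_le _

theorem IsDecomposition.groupIncl_mul {A B : Type*} {M : CoxeterMatrix B} {f : A ↪ B}
    {u : M.Group} {d : (restrict M f).Group × M.Group} (h : IsDecomposition M f u d)
    (x : (restrict M f).Group) : IsDecomposition M f (groupIncl M f x * u) (x * d.1, d.2) :=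
  ⟨by rw [map_mul, mul_assoc, ← h.1], h.2⟩

/-- The map `(u, X) ↦ (u₀, T ∩ u₁ W_X u₁⁻¹)`. -/
def projFun {A B : Type*} (M : CoxeterMatrix B) (f : A ↪ B) (p : Vertex M) :
    Vertex (restrict M f) :=
  ((decomposition M f p.1).1,
    ⟨conjTrace M f (decomposition M f p.1).2 p.2, conjTrace_mem_spherical M f _ p.2⟩)

theorem projFun_vle {A B : Type*} (M : CoxeterMatrix B) (f : A ↪ B) {p q : Vertex M}
    (h : VLE M p q) : VLE (restrict M f) (projFun M f p) (projFun M f q) := by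
  obtain ⟨⟨u, X⟩, ⟨v, Y⟩⟩ := p, q
  obtain ⟨hXY, hmem, hred⟩ := h
  dsimp only at hXY hmem hred
  obtain ⟨hu, hu₁⟩ := isDecomposition_decomposition M f u
  obtain ⟨hv, hv₁⟩ := isDecomposition_decomposition M f v
  simp only [VLE, projFun]
  generalize decomposition M f u = d at *
  generalize decomposition M f v = e at *
  obtain ⟨u₀, u₁⟩ := d
  obtain ⟨v₀, v₁⟩ := e
  dsimp only at *
  set y := v⁻¹ * u with hy
  have heq : v₁ * y = groupIncl M f (v₀⁻¹ * u₀) * u₁ := by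
    rw [hy, hu, hv, map_mul, map_inv]
    group
  generalize v₀⁻¹ * u₀ = x at *
  have hx := mem_parabolic_conjTrace M f hv₁ hu₁ hmem heq
  refine ⟨?_, hx, ?_⟩
  · intro a ha
    have ha' : u₁⁻¹ * M.simple (f a) * u₁ ∈ parabolic M Y := parabolic_mono M hXY ha
    have hx' := conj_groupIncl_mem M f hx
    change v₁⁻¹ * M.simple (f a) * v₁ ∈ parabolic M Y
    have hg : y = v₁⁻¹ * groupIncl M f x * u₁ := by rw [mul_assoc, ← heq]; group
    have e : v₁⁻¹ * M.simple (f a) * v₁ = (v₁⁻¹ * groupIncl M f x * v₁)⁻¹ *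
        (y * (u₁⁻¹ * M.simple (f a) * u₁) * y⁻¹) * (v₁⁻¹ * groupIncl M f x * v₁) := by
      rw [hg]
      group
    rw [e]
    exact mul_mem (mul_mem (inv_mem hx') (mul_mem (mul_mem hmem ha') (inv_mem hmem))) hx'
  · rw [isDoubleReduced_empty_left_iff] at hred ⊢
    intro a ha
    -- The two sides of `y u₁⁻¹ = v₁⁻¹ x` are applied to `α_a`. On the left `u₁⁻¹ α_a` is
    -- nonnegative with support in `X`, where `y` preserves sign. On the right a nonpositive `x
    -- α_a`, supported on `T`, would stay nonpositive under `v₁⁻¹`.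
    refine (geom_root_nonneg_or_nonpos _ x a).resolve_right fun hneg => ?_
    have h1 : 0 ≤ geom M (y * u₁⁻¹) (root (f a)) := by
      rw [geom_mul]
      exact geom_nonneg_of_support M hred
        ((isDoubleReduced_empty_right_iff M).mp hu₁ _ ⟨a, rfl⟩)
        fun b hb => geom_inv_root_apply_eq_zero M ha hb
    have e : y * u₁⁻¹ = v₁⁻¹ * groupIncl M f x := by
      rw [← mul_inv_eq_iff_eq_mul.mpr heq]
      group
    have h2 : 0 ≤ geom M v₁⁻¹ (rootIncl f (-geom (restrict M f) x (root a))) :=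
      geom_nonneg_of_support M ((isDoubleReduced_empty_right_iff M).mp hv₁)
        ((rootIncl_nonneg f).mpr (neg_nonneg.mpr hneg)) fun b hb => rootIncl_notMem f _ hb
    rw [map_neg, map_neg, ← geom_groupIncl_root, ← geom_mul, ← e] at h2
    exact geom_root_ne_zero M _ _ (le_antisymm (neg_nonneg.mp h2) h1)

theorem projFun_isProjection {A B : Type*} (M : CoxeterMatrix B) (f : A ↪ B) :
    IsProjection M f (projFun M f) := by
  refine fun u => ⟨existsUnique_isDecomposition M f u, fun d hd X => ?_⟩
  rw [← conjTrace_eq, ← hd.eq_decomposition]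
  exact ⟨rfl, rfl⟩

theorem vertexIncl_vle_iff {A B : Type*} (M : CoxeterMatrix B) (f : A ↪ B)
    {p q : Vertex (restrict M f)} :
    VLE M (vertexIncl M f p) (vertexIncl M f q) ↔ VLE (restrict M f) p q := by
  simp only [VLE, vertexIncl, isDoubleReduced_empty_left_iff, Set.forall_mem_image,
    ← map_inv, ← map_mul, geom_groupIncl_root, rootIncl_nonneg, ← map_parabolic,
    Set.image_subset_image_iff f.injective, Subgroup.mem_map_iff_mem (groupIncl_injective M f)]

theorem vertexIncl_injective {A B : Type*} (M : CoxeterMatrix B) (f : A ↪ B) :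
    Function.Injective (vertexIncl M f) := by
  intro p q h
  obtain ⟨h1, h2⟩ := Prod.ext_iff.mp h
  exact Prod.ext (groupIncl_injective M f h1)
    (Subtype.ext (f.injective.image_injective (congrArg Subtype.val h2)))

theorem projFun_vertexIncl {A B : Type*} (M : CoxeterMatrix B) (f : A ↪ B)
    (p : Vertex (restrict M f)) : projFun M f (vertexIncl M f p) = p := by
  have h := (isDecomposition_groupIncl M f p.1).eq_decomposition
  refine Prod.ext (congrArg (fun d => d.1) h) (Subtype.ext ?_)
  change conjTrace M f (decomposition M f (groupIncl M f p.1)).2 (f '' (p.2 : Set A)) = p.2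
  rw [h]
  ext a
  simp [conjTrace, simple_mem_parabolic_iff]

theorem projFun_groupIncl_mul {A B : Type*} (M : CoxeterMatrix B) (f : A ↪ B)
    (w : (restrict M f).Group) (p : Vertex M) :
    projFun M f (groupIncl M f w * p.1, p.2) =
      (w * (projFun M f p).1, (projFun M f p).2) := by
  have h := ((isDecomposition_decomposition M f p.1).groupIncl_mul w).eq_decomposition
  refine Prod.ext (congrArg (fun d => d.1) h) (Subtype.ext ?_)
  change conjTrace M f (decomposition M f (groupIncl M f w * p.1)).2 p.2 = _
  rw [h]
  rfl

/-- The embedding of `W_T × 𝒮^f_T` in `W × 𝒮^f`. -/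
def vertexEmb {A B : Type*} (M : CoxeterMatrix B) (f : A ↪ B) :
    VLE (restrict M f) ↪r VLE M where
  toFun := vertexIncl M f
  inj' := vertexIncl_injective M f
  map_rel_iff' := vertexIncl_vle_iff M f

/-- The projection of `W × 𝒮^f` onto `W_T × 𝒮^f_T`. -/
def projHom {A B : Type*} (M : CoxeterMatrix B) (f : A ↪ B) :
    VLE M →r VLE (restrict M f) where
  toFun := projFun M f
  map_rel' := projFun_vle M f

/-! ### Compatibility of the projections -/

theorem groupIncl_groupIncl {B : Type*} (M : CoxeterMatrix B) {T U : Set B} (h : T ⊆ U)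
    (x : (restrict M (incl T)).Group) :
    groupIncl M (incl U) (groupIncl (restrict M (incl U)) (inclOf h) x) =
      groupIncl M (incl T) x := by
  -- The ascription uses that restricting in two stages gives definitionally the same Coxeter matrix
  -- as restricting at once.
  have e : (groupIncl M (incl U)).comp (groupIncl (restrict M (incl U)) (inclOf h)) =
      (groupIncl M (incl T) : (restrict (restrict M (incl U)) (inclOf h)).Group →* M.Group) := by
    apply (restrict (restrict M (incl U)) (inclOf h)).toCoxeterSystem.ext_simple
    intro i
    refine Eq.trans ?_ (groupIncl_simple M (incl T) i).symm
    rw [CoxeterMatrix.toCoxeterSystem_simple, MonoidHom.comp_apply, groupIncl_simple,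
      groupIncl_simple]
    rfl
  exact DFunLike.congr_fun e x

/-- Only `t ∈ T` outside `R` needs an argument: `w⁻¹ ∈ W_R` leaves the coordinate of `α_t` at `t`
equal to 1, so `w⁻¹ α_t` is not negative. -/
theorem isDoubleReduced_groupIncl {B : Type*} (M : CoxeterMatrix B) {R T : Set B}
    {w : (restrict M (incl R)).Group}
    (hw : IsDoubleReduced (restrict M (incl R))
      (Set.range (inclOf (Set.inter_subset_left : R ∩ T ⊆ R))) ∅ w) :
    IsDoubleReduced M (Set.range (incl T)) ∅ (groupIncl M (incl R) w) := by
  rw [isDoubleReduced_empty_right_iff] at hw ⊢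
  rintro _ ⟨t, rfl⟩
  by_cases ht : (t : B) ∈ R
  · have h1 := hw ⟨t, ht⟩ ⟨⟨t, ht, t.2⟩, rfl⟩
    rw [← rootIncl_nonneg (incl R), ← geom_groupIncl_root, map_inv] at h1
    exact h1
  · refine (geom_root_nonneg_or_nonpos M _ _).resolve_right fun hneg => ?_
    have hmem : (groupIncl M (incl R) w)⁻¹ ∈ parabolic M (Set.range (incl R)) := by
      rw [← range_groupIncl]
      exact inv_mem ⟨w, rfl⟩
    have h1 := geom_parabolic_apply M hmem (root (t : B)) (b := t) (by simpa using ht)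
    have h2 := hneg (t : B)
    change geom M _ (root (t : B)) (t : B) ≤ 0 at h2
    rw [h1] at h2
    simp at h2
    norm_num at h2

theorem conjTrace_groupIncl {B : Type*} (M : CoxeterMatrix B) {R T : Set B}
    (w : (restrict M (incl R)).Group) (X : Set R) :
    conjTrace M (incl T) (groupIncl M (incl R) w) (incl R '' X) =
      inclOf (Set.inter_subset_right : R ∩ T ⊆ T) ''
        conjTrace (restrict M (incl R)) (inclOf (Set.inter_subset_left : R ∩ T ⊆ R)) w X := by
  have key : ∀ a : R, (groupIncl M (incl R) w)⁻¹ * M.simple a * groupIncl M (incl R) w ∈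
      parabolic M (incl R '' X) ↔
      w⁻¹ * (restrict M (incl R)).simple a * w ∈ parabolic (restrict M (incl R)) X := by
    intro a
    have e : M.simple (a : B) = groupIncl M (incl R) ((restrict M (incl R)).simple a) :=
      (groupIncl_simple M (incl R) a).symm
    rw [e, ← map_inv, ← map_mul, ← map_mul, ← map_parabolic,
      Subgroup.mem_map_iff_mem (groupIncl_injective M _)]
  ext t
  constructor
  · intro h
    change (groupIncl M (incl R) w)⁻¹ * M.simple (t : B) * groupIncl M (incl R) w ∈
      parabolic M (incl R '' X) at h
    -- A conjugate of `t` by an element of `W_R` lies in `W_R`, hence so does `t` itself.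
    have htR : (t : B) ∈ R := by
      have h1 := parabolic_mono M (Set.image_subset_range _ _) h
      have h2 : groupIncl M (incl R) w ∈ parabolic M (Set.range (incl R)) := by
        rw [← range_groupIncl]
        exact ⟨w, rfl⟩
      rw [Subgroup.mul_mem_cancel_right _ h2, Subgroup.mul_mem_cancel_left _ (inv_mem h2),
        simple_mem_parabolic_iff] at h1
      simpa using h1
    exact ⟨⟨t, htR, t.2⟩, (key ⟨t, htR⟩).mp h, rfl⟩
  · rintro ⟨a, ha, rfl⟩
    exact (key ⟨a, a.2.1⟩).mpr ha

theorem projFun_vertexIncl_inter {B : Type*} (M : CoxeterMatrix B) (R T : Set B)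
    (p : Vertex (restrict M (incl R))) :
    projFun M (incl T) (vertexIncl M (incl R) p) =
      vertexIncl (restrict M (incl T)) (inclOf (Set.inter_subset_right : R ∩ T ⊆ T))
        (projFun (restrict M (incl R)) (inclOf (Set.inter_subset_left : R ∩ T ⊆ R)) p) := by
  obtain ⟨h, hred⟩ := isDecomposition_decomposition (restrict M (incl R))
    (inclOf (Set.inter_subset_left : R ∩ T ⊆ R)) p.1
  set d := decomposition (restrict M (incl R))
    (inclOf (Set.inter_subset_left : R ∩ T ⊆ R)) p.1
  have h1 : IsDecomposition M (incl T) (groupIncl M (incl R) p.1)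
      (groupIncl (restrict M (incl T)) (inclOf (Set.inter_subset_right : R ∩ T ⊆ T)) d.1,
        groupIncl M (incl R) d.2) := by
    refine ⟨?_, isDoubleReduced_groupIncl M hred⟩
    rw [h, map_mul]
    congr 1
    exact (groupIncl_groupIncl M _ d.1).trans (groupIncl_groupIncl M _ d.1).symm
  have h2 := h1.eq_decomposition
  refine Prod.ext (congrArg (fun d => d.1) h2) (Subtype.ext ?_)
  change conjTrace M (incl T) (decomposition M (incl T) (groupIncl M (incl R) p.1)).2
    (incl R '' (p.2 : Set R)) = _
  rw [h2]
  exact conjTrace_groupIncl M d.2 p.2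

/-! ### Maps between geometric realizations -/

theorem realMap_realMap_eq {U V V' W : Type*} {q : U → U → Prop} {r : V → V → Prop}
    {r' : V' → V' → Prop} {s : W → W → Prop} {φ : q →r r} {ψ : r →r s} {φ' : q →r r'}
    {ψ' : r' →r s} (h : ∀ v, ψ (φ v) = ψ' (φ' v)) (x : Realization (derivedComplex q)) :
    realMap ψ (realMap φ x) = realMap ψ' (realMap φ' x) := by
  apply Realization.ext
  simp only [realMap, ← Finsupp.mapDomain_comp]
  exact congrArg (fun g => Finsupp.mapDomain g x.coord) (funext h)

theorem realMap_realMap_eq_self {U V : Type*} {q : U → U → Prop} {r : V → V → Prop}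
    {φ : q →r r} {ψ : r →r q} (h : ∀ v, ψ (φ v) = v) (x : Realization (derivedComplex q)) :
    realMap ψ (realMap φ x) = x := by
  apply Realization.ext
  simp only [realMap, ← Finsupp.mapDomain_comp]
  rw [show ψ ∘ φ = id from funext h, Finsupp.mapDomain_id]

theorem smul_eq_realMap {B : Type*} (M : CoxeterMatrix B) (w : M.Group) (x : Omega M) :
    w • x = realMap (translate M w) x :=
  rfl

/-- In the weak topology continuity is tested on closed simplices; there the map is the affine map
of standard simplices induced by `φ`, followed by the closed simplex on the image face. -/
theorem continuous_realMap {V V' : Type*} {r : V → V → Prop} {r' : V' → V' → Prop}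
    (φ : r →r r') : Continuous (realMap φ) := by
  classical
  rw [continuous_iSup_dom]
  intro s
  rw [continuous_coinduced_dom]
  have hs' : (s : Finset V).image φ ∈ (derivedComplex r').faces := by
    refine ⟨s.2.1.image φ, ?_⟩
    rw [Finset.coe_image]
    exact s.2.2.image_of_map_rel r r' φ fun _ _ h => φ.map_rel h
  let g : ↥(s : Finset V) → ↥((s : Finset V).image φ) :=
    fun v => ⟨φ v, Finset.mem_image_of_mem φ v.2⟩
  have e : realMap φ ∘ closedSimplex (derivedComplex r) s =
      closedSimplex (derivedComplex r') ⟨_, hs'⟩ ∘ stdSimplex.map g := by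
    funext x
    apply Realization.ext
    simp only [Function.comp_apply, realMap, closedSimplex, extendByZero,
      Finsupp.embDomain_eq_mapDomain, ← Finsupp.mapDomain_comp]
    change _ = Finsupp.mapDomain _ (Finsupp.equivFunOnFinite.symm
      (Finsupp.equivFunOnFinite (Finsupp.mapDomain g (Finsupp.equivFunOnFinite.symm x.1))))
    rw [Equiv.symm_apply_apply, ← Finsupp.mapDomain_comp]
    rfl
  rw [e]
  refine Continuous.comp ?_ (stdSimplex.continuous_map g)
  exact continuous_iSup_rng (i := (⟨_, hs'⟩ : (derivedComplex r').faces)) continuous_coinduced_rng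

end

end CDS

theorem theorem2p2 {B : Type*} [Finite B] (M : CoxeterMatrix B) :
    ∃ (ι : ∀ T : Set B, CDS.VLE (CDS.restrict M (CDS.incl T)) ↪r CDS.VLE M)
      (π : ∀ T : Set B, CDS.VLE M →r CDS.VLE (CDS.restrict M (CDS.incl T))),
      -- the embeddings and the retractions
      (∀ T : Set B,
        Function.Injective (CDS.groupIncl M (CDS.incl T)) ∧
        (CDS.groupIncl M (CDS.incl T)).range = CDS.parabolic M T ∧
        ⇑(ι T) = CDS.vertexIncl M (CDS.incl T) ∧
        CDS.IsProjection M (CDS.incl T) (π T) ∧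
        Topology.IsEmbedding (CDS.realMap (ι T).toRelHom) ∧
        Continuous (CDS.realMap (π T)) ∧
        (∀ x : CDS.Omega (CDS.restrict M (CDS.incl T)),
          CDS.realMap (π T) (CDS.realMap (ι T).toRelHom x) = x) ∧
        (∀ (w : (CDS.restrict M (CDS.incl T)).Group)
          (x : CDS.Omega (CDS.restrict M (CDS.incl T))),
          CDS.realMap (ι T).toRelHom (w • x) =
            CDS.groupIncl M (CDS.incl T) w • CDS.realMap (ι T).toRelHom x) ∧
        (∀ (w : (CDS.restrict M (CDS.incl T)).Group) (x : CDS.Omega M),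
          CDS.realMap (π T) (CDS.groupIncl M (CDS.incl T) w • x) =
            w • CDS.realMap (π T) x)) ∧
      -- compatibility: `κ` is the embedding of `Ω(Γ_{R ∩ T})` in `Ω(Γ_T)`, and `ρ` is the
      -- retraction of `Ω(Γ_R)` onto `Ω(Γ_{R ∩ T})`
      (∀ R T : Set B,
        ∃ (κ : CDS.VLE (CDS.restrict M (CDS.incl (R ∩ T))) ↪r
            CDS.VLE (CDS.restrict M (CDS.incl T)))
          (ρ : CDS.VLE (CDS.restrict M (CDS.incl R)) →r
            CDS.VLE (CDS.restrict M (CDS.incl (R ∩ T)))),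
          ⇑κ = CDS.vertexIncl (CDS.restrict M (CDS.incl T))
            (CDS.inclOf Set.inter_subset_right) ∧
          CDS.IsProjection (CDS.restrict M (CDS.incl R))
            (CDS.inclOf Set.inter_subset_left) ρ ∧
          ∀ x : CDS.Omega (CDS.restrict M (CDS.incl R)),
            CDS.realMap (π T) (CDS.realMap (ι R).toRelHom x) =
              CDS.realMap κ.toRelHom (CDS.realMap ρ x)) := by
  refine ⟨fun T => CDS.vertexEmb M (CDS.incl T), fun T => CDS.projHom M (CDS.incl T),
    fun T => ?_, fun R T => ?_⟩
  · have hret : ∀ x : CDS.Omega (CDS.restrict M (CDS.incl T)),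
        CDS.realMap (CDS.projHom M (CDS.incl T))
          (CDS.realMap (CDS.vertexEmb M (CDS.incl T)).toRelHom x) = x :=
      CDS.realMap_realMap_eq_self (CDS.projFun_vertexIncl M (CDS.incl T))
    -- The retraction is a continuous left inverse, which makes the continuous inclusion an
    -- embedding without any comparison of weak and subspace topologies.
    refine ⟨CDS.groupIncl_injective M _, ?_, rfl, CDS.projFun_isProjection M _,
      Function.LeftInverse.isEmbedding hret (CDS.continuous_realMap _) (CDS.continuous_realMap _),
      CDS.continuous_realMap _, hret, fun w x => ?_, fun w x => ?_⟩
    · rw [CDS.range_groupIncl]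
      simp
    · rw [CDS.smul_eq_realMap, CDS.smul_eq_realMap]
      refine CDS.realMap_realMap_eq (fun p => ?_) x
      exact Prod.ext (map_mul (CDS.groupIncl M (CDS.incl T)) w p.1) rfl
    · rw [CDS.smul_eq_realMap, CDS.smul_eq_realMap]
      exact CDS.realMap_realMap_eq (CDS.projFun_groupIncl_mul M (CDS.incl T) w) x
  · refine ⟨CDS.vertexEmb (CDS.restrict M (CDS.incl T)) (CDS.inclOf Set.inter_subset_right),
      CDS.projHom (CDS.restrict M (CDS.incl R)) (CDS.inclOf Set.inter_subset_left),
      rfl, CDS.projFun_isProjection _ _, fun x => ?_⟩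
    exact CDS.realMap_realMap_eq (CDS.projFun_vertexIncl_inter M R T) x
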